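/- For non-negative integers $t,p,q$ let the generalized book graph $B_t(p,q)$ consist of an edge $uv$, $t$ vertices joined to both $u$ and $v$, $p$ vertices joined only to $u$, and $q$ vertices joined only to $v$. Let $\mathcal N(H,G)$ denote the number of (not necessarily induced) copies of $H$ in $G$, i.e. the number of subgraphs of $G$ isomorphic to $H$. Let $A$ be the set of graph parameters $Q$ of the form $$Q(G)=\sum_{0\le t,p,q\le k} w_{t,p,q}\,\mathcal N(B_t(p,q),G)$$ with $k$ a non-negative integer and real coefficients $w_{t,p,q}\ge 0$ ($k$ and the coefficients depending only on $Q$). For integers $n\ge 0$ and $0\le m\le\binom n2$, write $m=\binom a2+b$ with $0\le b<a$ (in the unique way). The quasi-clique $K_n^m$ is the graph on the vertices $0,\dots,n-1$ with $m$ edges in which the vertices less than $a$ form a clique, the vertex $a$ (if $b>0$) is joined to the vertices $0,\dots,b-1$, and there are no other edges. **Proposition.** For each $Q\in A$ there are a constant $c>0$ and a sequence $\delta_n$ (both depending only on $Q$) with $\delta_n\to 0$ as $n\to\infty$ such that for all $n$ and $m$ with $m\ge(1-c)\binom n2$ and every $n$-vertex graph $G$ with $m$ edges, $$Q(G)\le(1+\delta_n)\,Q(K_n^m).$$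 -/

import Mathlib

open Filter Topology

/-- The vertices of the generalized book graph `B_t(p,q)`: the two rootlet vertices `u`, `v`,
the `t` page vertices, the `p` leaves at `u` and the `q` leaves at `v`. -/
inductive BookVertex (t p q : ℕ) : Type
  | u : BookVertex t p q
  | v : BookVertex t p q
  | page (i : Fin t) : BookVertex t p q
  | leafU (i : Fin p) : BookVertex t p q
  | leafV (i : Fin q) : BookVertex t p q
  deriving DecidableEq, Fintype

/-- The edges of the generalized book graph, each listed in one direction. -/
inductive BookEdge (t p q : ℕ) : BookVertex t p q → BookVertex t p q → Prop
  | root : BookEdge t p q .u .v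
  | pageU (i : Fin t) : BookEdge t p q .u (.page i)
  | pageV (i : Fin t) : BookEdge t p q .v (.page i)
  | leafU (i : Fin p) : BookEdge t p q .u (.leafU i)
  | leafV (i : Fin q) : BookEdge t p q .v (.leafV i)

/-- The generalized book graph `B_t(p,q)`: an edge `uv`, `t` vertices joined to both `u` and `v`,
`p` vertices joined to `u` only and `q` vertices joined to `v` only. -/
def generalizedBook (t p q : ℕ) : SimpleGraph (BookVertex t p q) :=
  SimpleGraph.fromRel (BookEdge t p q)

/-- Real-valued parameters of finite graphs. -/
abbrev GraphParameter : Type 1 := ∀ (V : Type) [Fintype V], SimpleGraph V → ℝ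

/-- The class `A` of parameters `∑_{t,p,q ≤ k} w_{t,p,q} N(B_t(p,q), G)` with `w_{t,p,q} ≥ 0`, where
`N(H, G)` is the number of (not necessarily induced) copies of `H` in `G`, that is, the number of
subgraphs of `G` isomorphic to `H`. -/
def classA : Set GraphParameter :=
  {Q | ∃ (k : ℕ) (w : ℕ → ℕ → ℕ → ℝ), (∀ t p q, 0 ≤ w t p q) ∧
    ∀ (V : Type) [Fintype V] (G : SimpleGraph V),
      Q V G = ∑ t ∈ Finset.range (k + 1), ∑ p ∈ Finset.range (k + 1), ∑ q ∈ Finset.range (k + 1),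
        w t p q * (G.copyCount (generalizedBook t p q) : ℝ)}

/-- The `a` in the decomposition `m = a.choose 2 + b`, `0 ≤ b < a`. -/
def cliqueSize (m : ℕ) : ℕ := Nat.findGreatest (fun a => a.choose 2 ≤ m) (m + 1)

/-- The `b` in the decomposition `m = a.choose 2 + b`, `0 ≤ b < a`. -/
def cliqueRest (m : ℕ) : ℕ := m - (cliqueSize m).choose 2

theorem clique_decomposition (m : ℕ) :
    m = (cliqueSize m).choose 2 + cliqueRest m ∧ cliqueRest m < cliqueSize m := by
  have h1 : (cliqueSize m).choose 2 ≤ m :=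
    Nat.findGreatest_spec (P := fun a => a.choose 2 ≤ m) (m := 0) (by omega) (by simp)
  have h2 : m < (cliqueSize m + 1).choose 2 := by
    by_contra! h
    rcases Nat.lt_or_ge (m + 1) (cliqueSize m + 1) with hlt | hle
    · have h3 : (m + 2).choose 2 ≤ m :=
        (Nat.choose_le_choose 2 (by omega)).trans h
      have h4 : (m + 2).choose 2 = (m + 1) + (m + 1).choose 2 := by
        simp [Nat.choose_succ_succ', add_comm]
      omega
    · exact absurd h (Nat.findGreatest_is_greatest (P := fun a => a.choose 2 ≤ m)
        (Nat.lt_succ_self _) hle)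
  have h5 : (cliqueSize m + 1).choose 2 = cliqueSize m + (cliqueSize m).choose 2 := by
    simp [Nat.choose_succ_succ']
  unfold cliqueRest
  omega

theorem clique_decomposition_unique {m a b : ℕ} (h : m = a.choose 2 + b) (hb : b < a) :
    a = cliqueSize m ∧ b = cliqueRest m := by
  obtain ⟨h', hb'⟩ := clique_decomposition m
  have key : ∀ x y : ℕ, x < y → x + x.choose 2 ≤ y.choose 2 := by
    intro x y hxy
    have h1 : (x + 1).choose 2 = x + x.choose 2 := by simp [Nat.choose_succ_succ']
    exact h1 ▸ Nat.choose_le_choose 2 hxy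
  have ha : a = cliqueSize m := by
    rcases lt_trichotomy a (cliqueSize m) with hl | he | hl
    · have := key _ _ hl; omega
    · exact he
    · have := key _ _ hl; omega
  refine ⟨ha, ?_⟩
  rw [← ha] at h'
  omega

/-- The quasi-clique `K_n^m` on the vertices `0, …, n - 1`. With `m = a.choose 2 + b`, `0 ≤ b < a`,
the vertices `0, …, a - 1` form a clique, the vertex `a` is joined to `0, …, b - 1`, and there are
no other edges. -/
def quasiClique (n m : ℕ) : SimpleGraph (Fin n) :=
  SimpleGraph.fromRel fun i j =>
    (i.val < cliqueSize m ∧ j.val < cliqueSize m) ∨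
      (i.val < cliqueRest m ∧ j.val = cliqueSize m)

/-! Near density one, every book on `r` vertices has at most `(2m)^(r/2)` labelled copies, and the
clique inside the quasi-clique already attains this up to a factor `1 + o(1)`. Nonnegative weights
let each book be treated separately.

For the upper bound, forget that pages are joined to `v`: copies become weighted double brooms,
which symmetrisation bounds by stars, i.e. by a degree moment
(`sum_mul_degree_pow_mul_degree_pow_le`). The core is `sum_degree_pow_le_sqrt_pow`. Split off the
set `S` of vertices of noticeably low degree and compare with the clique on the rest `R`. Both the
moment and the clique bound are expanded to first order in the edges meeting `S` and the non-edges
inside `R`; the non-edge terms cancel, and edges meeting `S` gain less in the moment than in the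
bound because degrees in `S` fall short by a factor `1 - τ`. -/

/-! ### Degree moments of dense weighted graphs -/

theorem pow_succ_add_mul_sub_le_pow_succ {a b : ℝ} (hb : 0 ≤ b) (hab : b ≤ a) (k : ℕ) :
    b ^ (k + 1) + (k + 1) * (a - b) * b ^ k ≤ a ^ (k + 1) := by
  induction k with
  | zero => simp
  | succ k ih =>
    have h1 := mul_le_mul_of_nonneg_right ih (hb.trans hab)
    have h2 : 0 ≤ (k + 1) * (a - b) ^ 2 * b ^ k := by positivity
    push_cast
    have e1 : a ^ (k + 1 + 1) = a ^ (k + 1) * a := pow_succ _ _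
    have e2 : b ^ (k + 1 + 1) = b ^ k * b * b := by ring
    have e3 : b ^ (k + 1) = b ^ k * b := by ring
    rw [e1, e2, e3]
    rw [e3] at h1
    nlinarith [h1, h2]

theorem pow_succ_le_pow_succ_add_mul_sub {a b : ℝ} (hb : 0 ≤ b) (hab : b ≤ a) (ha : a ≤ 1)
    (k : ℕ) : a ^ (k + 1) ≤ b ^ (k + 1) + (k + 1) * (a - b) := by
  induction k with
  | zero => simp
  | succ k ih =>
    have ha0 : 0 ≤ a := hb.trans hab
    have h1 := mul_le_mul_of_nonneg_right ih ha0
    have hb1 : b ^ (k + 1) ≤ 1 := pow_le_one₀ hb (hab.trans ha)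
    have h2 : b ^ (k + 1) * (a - b) ≤ 1 * (a - b) :=
      mul_le_mul_of_nonneg_right hb1 (by linarith)
    have h3 : (k + 1 : ℝ) * (a - b) * a ≤ (k + 1) * (a - b) * 1 :=
      mul_le_mul_of_nonneg_left ha (by have := sub_nonneg.2 hab; positivity)
    push_cast
    rw [pow_succ a, pow_succ b (k + 1)]
    nlinarith [h1, h2, h3]

/-- The tangent line inequality for `x ↦ x ^ ((k + 2) / 2)` at `v ^ 2`, evaluated at `w ^ 2`. -/
theorem pow_add_two_tangent_le {v w : ℝ} (hv : 0 ≤ v) (hw : 0 ≤ w) (k : ℕ) :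
    v ^ (k + 2) + (k + 2) / 2 * v ^ k * (w ^ 2 - v ^ 2) ≤ w ^ (k + 2) := by
  induction k with
  | zero => simp
  | succ k ih =>
    have h1 := mul_le_mul_of_nonneg_right ih hw
    -- The exact error of the inductive step: it vanishes to second order at `w = v`.
    have h2 : 0 ≤ v ^ k * ((w - v) ^ 2 * ((k + 2) / 2 * w + (k + 1) / 2 * v)) := by positivity
    calc v ^ (k + 1 + 2) + ((k + 1 : ℕ) + 2) / 2 * v ^ (k + 1) * (w ^ 2 - v ^ 2)
        = (v ^ (k + 2) + (k + 2) / 2 * v ^ k * (w ^ 2 - v ^ 2)) * w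
          - v ^ k * ((w - v) ^ 2 * ((k + 2) / 2 * w + (k + 1) / 2 * v)) := by
            push_cast; ring
      _ ≤ w ^ (k + 2) * w := by linarith
      _ = w ^ (k + 1 + 2) := by ring

/-- Since `σ + h ≤ 2τ`, Bernoulli gives `(1 - σ - h)^k ≥ (k + 2) / (2(k + 1))`; `τ` is chosen for
exactly this. Hence the loss rate `k + 1` of a single power, taken at the lower end, still beats the
rate `(k + 2) / 2` of the tangent line for the clique bound. -/
theorem one_sub_pow_le_of_small_deficiency {k : ℕ} {σ e h τ : ℝ} (hτ : τ = 1 / (4 * (k + 1)))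
    (hσ : σ ≤ τ) (he : 0 ≤ e) (heσ : e ≤ σ) (hh : 0 ≤ h) (hy : σ - e + h ≤ τ) :
    (1 - (σ - e + h)) ^ (k + 1) ≤
      (1 - σ) ^ (k + 1) - (k + 2) / 2 * (1 - σ) ^ k * h + (k + 1) * e := by
  have hk : (0 : ℝ) ≤ k := k.cast_nonneg
  have hτ1 : τ * (4 * (k + 1)) = 1 := by rw [hτ]; field_simp
  have hτ2 : τ ≤ 1 / 4 := by nlinarith
  have hz : 1 - 2 * τ ≤ 1 - σ - h := by linarith
  have hz0 : 0 ≤ 1 - σ - h := by linarith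
  have h1 := pow_succ_le_pow_succ_add_mul_sub (a := 1 - (σ - e + h)) hz0 (by linarith)
    (by linarith) k
  have h2 := pow_succ_add_mul_sub_le_pow_succ (a := 1 - σ) hz0 (by linarith) k
  have h3 : 1 - 2 * τ * k ≤ (1 - σ - h) ^ k := by
    have h31 := one_add_mul_le_pow (a := -(2 * τ)) (by linarith) k
    have h32 : (1 + -(2 * τ)) ^ k ≤ (1 - σ - h) ^ k :=
      pow_le_pow_left₀ (by linarith) (by linarith) k
    linarith
  have h4 : (1 - σ) ^ k ≤ 1 := pow_le_one₀ (by linarith) (by linarith)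
  have h5 : (k + 2) / 2 * (1 - σ) ^ k ≤ (k + 1) * (1 - σ - h) ^ k := by nlinarith
  have h6 := mul_le_mul_of_nonneg_right h5 hh
  nlinarith

/-- At `σ = 0` the inequality has slack at least `τ * ε`; replacing `(1 - σ)^k` by 1 costs at most
`k(k + 2)σ * ε` in the `ε` term, which this slack pays for. -/
theorem deficiency_weight_le {k : ℕ} {σ τ ε δ : ℝ} (hk1 : (1 : ℝ) ≤ k) (hσ0 : 0 ≤ σ)
    (hτle : τ ≤ 1 / 4) (hσle : σ * (k + 1) ^ 2 ≤ τ) (hε0 : 0 ≤ ε) (hδ0 : 0 ≤ δ) :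
    (1 - τ) * ε + (k + 1) * (ε - δ) ≤ (k + 2) / 2 * (1 - σ) ^ k * (2 * ε - δ) := by
  have hστ : σ ≤ τ := (le_mul_of_one_le_right hσ0 (one_le_pow₀ (by linarith))).trans hσle
  have hlam1 : (1 - σ) ^ k ≤ 1 := pow_le_one₀ (by linarith) (by linarith)
  have hlam : 1 - k * σ ≤ (1 - σ) ^ k := by
    have := one_add_mul_le_pow (a := -σ) (by linarith) k
    rw [← sub_eq_add_neg] at this
    linarith
  have h3 : (1 - τ) + (k + 1) ≤ (k + 2) * (1 - σ) ^ k := by nlinarith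
  have h4 : (k + 2) / 2 * (1 - σ) ^ k ≤ k + 1 := by nlinarith
  nlinarith [mul_le_mul_of_nonneg_right h3 hε0, mul_le_mul_of_nonneg_right h4 hδ0]

/-- A dense weighted graph has `(k + 1)`-st degree moment at most that of a clique of the same
density. -/
theorem sum_degree_pow_le_sqrt_pow {V : Type*} [Fintype V] (A : V → V → ℝ)
    (hsymm : ∀ u v, A u v = A v u) (h0 : ∀ u v, 0 ≤ A u v) (h1 : ∀ u v, A u v ≤ 1) {k : ℕ}
    (hk : 1 ≤ k)
    (hdense : (Fintype.card V : ℝ) ^ 2 - ∑ v, ∑ u, A v u ≤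
      (Fintype.card V : ℝ) ^ 2 / (16 * (k + 1) ^ 4)) :
    ∑ v, (∑ u, A v u) ^ (k + 1) ≤ √(∑ v, ∑ u, A v u) ^ (k + 2) := by
  classical
  rcases isEmpty_or_nonempty V with hV | hV
  · simp
  have hN : (0 : ℝ) < Fintype.card V := by exact_mod_cast Fintype.card_pos
  obtain ⟨N, hNdef⟩ : ∃ N : ℝ, N = Fintype.card V := ⟨_, rfl⟩
  rw [← hNdef] at hN hdense
  have hk1 : (1 : ℝ) ≤ k := by exact_mod_cast hk
  obtain ⟨τ, hτ⟩ : ∃ τ : ℝ, τ = 1 / (4 * (k + 1)) := ⟨_, rfl⟩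
  have hτ0 : 0 < τ := by rw [hτ]; positivity
  have hτ1 : τ * (4 * (k + 1)) = 1 := by rw [hτ]; field_simp
  obtain ⟨y, hd⟩ : ∃ y : V → ℝ, ∀ v, ∑ u, A v u = N * (1 - y v) :=
    ⟨fun v => 1 - (∑ u, A v u) / N, fun v => by field_simp; ring⟩
  have hy0 : ∀ v, 0 ≤ y v := by
    intro v
    have : ∑ u, A v u ≤ N := by
      calc ∑ u, A v u ≤ ∑ _u : V, (1 : ℝ) := Finset.sum_le_sum fun u _ => h1 v u
        _ = N := by simp [hNdef]
    rw [hd] at this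
    nlinarith
  have hy1 : ∀ v, y v ≤ 1 := by
    intro v
    have : 0 ≤ ∑ u, A v u := Finset.sum_nonneg fun u _ => h0 v u
    rw [hd] at this
    exact sub_nonneg.1 (nonneg_of_mul_nonneg_right this hN)
  obtain ⟨S, R, hS, hR, split⟩ : ∃ S R : Finset V, (∀ v ∈ S, τ ≤ y v) ∧ (∀ v ∈ R, y v < τ) ∧
      ∀ f : V → ℝ, ∑ v, f v = ∑ v ∈ S, f v + ∑ v ∈ R, f v :=
    ⟨Finset.univ.filter fun v => τ ≤ y v, Finset.univ.filter fun v => ¬ τ ≤ y v,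
      fun v hv => (Finset.mem_filter.1 hv).2, fun v hv => not_le.1 (Finset.mem_filter.1 hv).2,
      fun f => (Finset.sum_filter_add_sum_filter_not _ _ _).symm⟩
  have scale : ∀ a : ℝ, ∃ b, a = N * b := fun a => ⟨a / N, by field_simp⟩
  obtain ⟨σ, hSc⟩ := scale S.card
  have hRc : (R.card : ℝ) = N * (1 - σ) := by
    have := split fun _ => 1
    simp only [Finset.sum_const, nsmul_eq_mul, mul_one, Finset.card_univ] at this
    rw [← hNdef] at this
    linarith
  have hσ0 : 0 ≤ σ := nonneg_of_mul_nonneg_right (hSc ▸ S.card.cast_nonneg) hN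
  -- Up to the factor `N`, `e v` is the weight from `v` to `S` and `h v` the weight missing from `v`
  -- to `R`, the diagonal included.
  choose e he using fun v => scale (∑ u ∈ S, A v u)
  choose h hh using fun v => scale (∑ u ∈ R, (1 - A v u))
  have he0 : ∀ v, 0 ≤ e v := fun v =>
    nonneg_of_mul_nonneg_right (he v ▸ Finset.sum_nonneg fun u _ => h0 v u) hN
  have hh0 : ∀ v, 0 ≤ h v := fun v =>
    nonneg_of_mul_nonneg_right (hh v ▸ Finset.sum_nonneg fun u _ => sub_nonneg.2 (h1 v u)) hN
  have heσ : ∀ v, e v ≤ σ := by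
    intro v
    refine le_of_mul_le_mul_left ?_ hN
    rw [← he, ← hSc]
    calc ∑ u ∈ S, A v u ≤ ∑ _u ∈ S, (1 : ℝ) := Finset.sum_le_sum fun u _ => h1 v u
      _ = S.card := by simp
  have hyv : ∀ v, y v = σ - e v + h v := by
    intro v
    have h2 := split fun u => A v u
    have h3 : ∑ u ∈ R, (1 - A v u) = N * (1 - σ) - ∑ u ∈ R, A v u := by
      rw [Finset.sum_sub_distrib]; simp [hRc]
    rw [hd, he] at h2
    rw [hh] at h3
    refine mul_left_cancel₀ hN.ne' ?_
    linarith
  obtain ⟨ε, hεN⟩ := scale (∑ v ∈ S, (1 - y v))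
  obtain ⟨εS, hεSN⟩ := scale (∑ v ∈ S, e v)
  obtain ⟨ρ, hρN⟩ := scale (∑ v ∈ R, h v)
  have hε0 : 0 ≤ ε :=
    nonneg_of_mul_nonneg_right (hεN ▸ Finset.sum_nonneg fun v _ => sub_nonneg.2 (hy1 v)) hN
  have hεS0 : 0 ≤ εS :=
    nonneg_of_mul_nonneg_right (hεSN ▸ Finset.sum_nonneg fun v _ => he0 v) hN
  -- Double counting by symmetry: the weight sent into `S` is the total degree of `S`.
  have hesum : ∑ v, e v = N * ε := by
    rw [← hεN]
    refine mul_left_cancel₀ hN.ne' ?_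
    rw [Finset.mul_sum, Finset.mul_sum, Finset.sum_congr rfl fun v _ => (he v).symm,
      Finset.sum_comm]
    refine Finset.sum_congr rfl fun u _ => ?_
    rw [Finset.sum_congr rfl fun v _ => hsymm v u, hd u]
  have heR : ∑ v ∈ R, e v = N * (ε - εS) := by
    have := split e
    rw [hesum, hεSN] at this
    linarith
  obtain ⟨x, hxN⟩ := scale (∑ v, y v)
  have htot : ∑ v, ∑ u, A v u = N ^ 2 * (1 - x) := by
    rw [Finset.sum_congr rfl fun v _ => hd v, ← Finset.mul_sum, Finset.sum_sub_distrib, hxN]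
    simp only [Finset.sum_const, nsmul_eq_mul, mul_one, Finset.card_univ]
    rw [← hNdef]
    ring
  have hxle : x ≤ τ ^ 2 / (k + 1) ^ 2 := by
    rw [htot] at hdense
    have h2 : N ^ 2 * x ≤ N ^ 2 * (1 / (16 * (k + 1) ^ 4)) := by
      rw [mul_one_div]; linarith
    have h3 := le_of_mul_le_mul_left h2 (by positivity)
    rw [hτ]
    refine h3.trans_eq ?_
    field_simp
    norm_num
  have hσx : σ * τ ≤ x := by
    have h2 : N * (σ * τ) ≤ N * x := by
      rw [← hxN, split y]
      have h3 : ∑ _v ∈ S, τ ≤ ∑ v ∈ S, y v :=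
        Finset.sum_le_sum hS
      have h4 : 0 ≤ ∑ v ∈ R, y v := Finset.sum_nonneg fun v _ => hy0 v
      rw [Finset.sum_const, nsmul_eq_mul, hSc] at h3
      linarith
    exact le_of_mul_le_mul_left h2 hN
  have hσle : σ * (k + 1) ^ 2 ≤ τ := by
    have h2 : σ * τ ≤ τ ^ 2 / (k + 1) ^ 2 := hσx.trans hxle
    rw [le_div_iff₀ (by positivity)] at h2
    exact le_of_mul_le_mul_right (by nlinarith) hτ0
  have hστ : σ ≤ τ := (le_mul_of_one_le_right hσ0 (one_le_pow₀ (by linarith))).trans hσle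
  have hτle : τ ≤ 1 / 4 := by nlinarith
  -- Density relative to the clique on `R`: weight meeting `S` is added (`εS` corrects double
  -- counting), and `ρ` is missing inside `R`.
  have hx1 : 1 - x = (1 - σ) ^ 2 + (2 * ε - εS - ρ) := by
    have h2 := split fun v => 1 - y v
    have h3 : ∑ v ∈ R, (1 - y v) = N * (1 - σ) * (1 - σ) + N * (ε - εS) - N * ρ := by
      rw [← heR, ← hρN, ← hRc, Finset.sum_congr rfl fun v _ => by
        rw [show 1 - y v = (1 - σ) + e v - h v by rw [hyv]; ring], Finset.sum_sub_distrib,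
        Finset.sum_add_distrib, Finset.sum_const, nsmul_eq_mul]
    rw [hεN, h3, Finset.sum_sub_distrib, hxN] at h2
    simp only [Finset.sum_const, nsmul_eq_mul, mul_one, Finset.card_univ] at h2
    rw [← hNdef] at h2
    have h4 : N * (1 - x) = N * ((1 - σ) ^ 2 + (2 * ε - εS - ρ)) := by linarith
    exact mul_left_cancel₀ hN.ne' h4
  have hx1' : 0 ≤ 1 - x := by
    have h2 : 0 ≤ N ^ 2 * (1 - x) := by
      rw [← htot]
      exact Finset.sum_nonneg fun v _ => Finset.sum_nonneg fun u _ => h0 v u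
    exact nonneg_of_mul_nonneg_right h2 (by positivity)
  -- The saving `1 - τ` on low-degree vertices needs `k ≥ 1`.
  have hSsum : ∑ v ∈ S, (1 - y v) ^ (k + 1) ≤ (1 - τ) * (N * ε) := by
    rw [← hεN, Finset.mul_sum]
    refine Finset.sum_le_sum fun v hv => ?_
    have hv' := hS v hv
    have h2 : (1 - y v) ^ k ≤ 1 - y v := by
      calc (1 - y v) ^ k ≤ (1 - y v) ^ 1 :=
            pow_le_pow_of_le_one (by linarith [hy1 v]) (by linarith [hy0 v]) hk
        _ = 1 - y v := pow_one _
    rw [pow_succ]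
    exact mul_le_mul_of_nonneg_right (by linarith) (by linarith [hy1 v])
  have hRsum : ∑ v ∈ R, (1 - y v) ^ (k + 1) ≤
      N * (1 - σ) * (1 - σ) ^ (k + 1) - (k + 2) / 2 * (1 - σ) ^ k * (N * ρ)
        + (k + 1) * (N * (ε - εS)) := by
    rw [← heR, ← hρN, ← hRc, Finset.mul_sum, Finset.mul_sum, ← nsmul_eq_mul, ← Finset.sum_const,
      ← Finset.sum_sub_distrib, ← Finset.sum_add_distrib]
    refine Finset.sum_le_sum fun v hv => ?_
    have hv' := hR v hv
    rw [hyv] at hv' ⊢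
    exact one_sub_pow_le_of_small_deficiency hτ hστ (he0 v) (heσ v) (hh0 v) hv'.le
  have hmom : ∑ v, (1 - y v) ^ (k + 1) ≤ N * √(1 - x) ^ (k + 2) := by
    rw [split]
    have h2 := pow_add_two_tangent_le (v := 1 - σ) (by linarith) (Real.sqrt_nonneg (1 - x)) k
    rw [Real.sq_sqrt hx1', hx1, add_sub_cancel_left, ← hx1] at h2
    have h5 := deficiency_weight_le hk1 hσ0 hτle hσle hε0 hεS0
    have h6 := mul_le_mul_of_nonneg_left h2 hN.le
    have h7 := mul_le_mul_of_nonneg_left h5 hN.le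
    have h8 : (1 - σ) ^ (k + 2) = (1 - σ) * (1 - σ) ^ (k + 1) := by ring
    rw [h8] at h6
    linarith
  rw [htot, Real.sqrt_mul (by positivity), Real.sqrt_sq hN.le, mul_pow,
    Finset.sum_congr rfl fun v _ => by rw [hd v, mul_pow], ← Finset.mul_sum]
  calc N ^ (k + 1) * ∑ v, (1 - y v) ^ (k + 1) ≤ N ^ (k + 1) * (N * √(1 - x) ^ (k + 2)) := by
        gcongr
    _ = N ^ (k + 2) * √(1 - x) ^ (k + 2) := by ring

/-! ### Double brooms versus stars -/

/-- Rearrangement: `x ^ a - y ^ a` and `x ^ b - y ^ b` never have opposite signs. -/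
theorem pow_mul_pow_add_le_pow_add {x y : ℝ} (hx : 0 ≤ x) (hy : 0 ≤ y) (a b : ℕ) :
    x ^ a * y ^ b + y ^ a * x ^ b ≤ x ^ (a + b) + y ^ (a + b) := by
  have h : 0 ≤ (x ^ a - y ^ a) * (x ^ b - y ^ b) := by
    rcases le_total x y with hxy | hxy
    · exact mul_nonneg_of_nonpos_of_nonpos (sub_nonpos.2 (pow_le_pow_left₀ hx hxy a))
        (sub_nonpos.2 (pow_le_pow_left₀ hx hxy b))
    · exact mul_nonneg (sub_nonneg.2 (pow_le_pow_left₀ hy hxy a))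
        (sub_nonneg.2 (pow_le_pow_left₀ hy hxy b))
  rw [pow_add, pow_add]
  linarith

/-- Weighted double brooms are at most as frequent as stars with the same number of edges. -/
theorem sum_mul_degree_pow_mul_degree_pow_le {V : Type*} [Fintype V] (A : V → V → ℝ)
    (hsymm : ∀ u v, A u v = A v u) (h0 : ∀ u v, 0 ≤ A u v) (d : V → ℝ)
    (hd : ∀ v, d v = ∑ u, A v u) (a b : ℕ) :
    ∑ v, ∑ u, A v u * (d v ^ a * d u ^ b) ≤ ∑ v, d v ^ (a + b + 1) := by
  have hd0 : ∀ v, 0 ≤ d v := fun v => hd v ▸ Finset.sum_nonneg fun u _ => h0 v u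
  have h1 : ∑ v, ∑ u, A v u * (d v ^ a * d u ^ b) = ∑ v, ∑ u, A v u * (d u ^ a * d v ^ b) := by
    rw [Finset.sum_comm]
    exact Finset.sum_congr rfl fun v _ => Finset.sum_congr rfl fun u _ => by rw [hsymm]
  have h2 : ∑ v, ∑ u, A v u * d v ^ (a + b) = ∑ v, d v ^ (a + b + 1) :=
    Finset.sum_congr rfl fun v _ => by rw [← Finset.sum_mul, ← hd, pow_succ']
  have h3 : ∑ v, ∑ u, A v u * d u ^ (a + b) = ∑ v, d v ^ (a + b + 1) := by
    rw [← h2, Finset.sum_comm]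
    exact Finset.sum_congr rfl fun v _ => Finset.sum_congr rfl fun u _ => by rw [hsymm]
  have h4 : ∑ v, ∑ u, A v u * (d v ^ a * d u ^ b) + ∑ v, ∑ u, A v u * (d u ^ a * d v ^ b) ≤
      ∑ v, ∑ u, A v u * d v ^ (a + b) + ∑ v, ∑ u, A v u * d u ^ (a + b) := by
    simp only [← Finset.sum_add_distrib, ← mul_add]
    exact Finset.sum_le_sum fun v _ => Finset.sum_le_sum fun u _ =>
      mul_le_mul_of_nonneg_left (pow_mul_pow_add_le_pow_add (hd0 v) (hd0 u) a b) (h0 v u)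
  linarith

/-! ### Labelled and unlabelled copies -/

namespace SimpleGraph

/-- A labelled copy is a subgraph together with an isomorphism onto it. -/
theorem bijective_coeCopy_comp {V W : Type*} (G : SimpleGraph V) (H : SimpleGraph W) :
    Function.Bijective fun x : (Σ G' : {G' : G.Subgraph // Nonempty (H ≃g G'.coe)},
      (H ≃g G'.1.coe)) => x.1.1.coeCopy.comp x.2.toCopy := by
  have hsub : ∀ (G' : G.Subgraph) (e : H ≃g G'.coe),
      (G'.coeCopy.comp e.toCopy).toSubgraph = G' := by
    intro G' e
    ext u v
    · simp only [Copy.toSubgraph, Subgraph.map_verts, Subgraph.verts_top, Set.image_univ,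
        Set.mem_range]
      constructor
      · rintro ⟨w, rfl⟩
        exact (e w).2
      · intro hu
        exact ⟨e.symm ⟨u, hu⟩, congrArg Subtype.val (e.apply_symm_apply ⟨u, hu⟩)⟩
    · simp only [Copy.toSubgraph, Subgraph.map_adj, Relation.map_apply, Subgraph.top_adj]
      constructor
      · rintro ⟨a, b, hab, rfl, rfl⟩
        exact e.map_rel_iff.2 hab
      · intro huv
        refine ⟨e.symm ⟨u, huv.fst_mem⟩, e.symm ⟨v, huv.snd_mem⟩, ?_,
          congrArg Subtype.val (e.apply_symm_apply ⟨u, huv.fst_mem⟩),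
          congrArg Subtype.val (e.apply_symm_apply ⟨v, huv.snd_mem⟩)⟩
        exact e.symm.map_rel_iff.2 huv
  constructor
  · rintro ⟨⟨G₁, h₁⟩, e₁⟩ ⟨⟨G₂, h₂⟩, e₂⟩ h
    have hG : G₁ = G₂ := by
      rw [← hsub G₁ e₁, ← hsub G₂ e₂]
      exact congrArg Copy.toSubgraph h
    subst hG
    have he : e₁ = e₂ := by
      ext w
      exact DFunLike.congr_fun h w
    rw [he]
  · intro f
    exact ⟨⟨⟨f.toSubgraph, ⟨f.isoToSubgraph⟩⟩, f.isoToSubgraph⟩, Copy.ext fun w => rfl⟩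

/-- Composing with one fixed isomorphism identifies the labellings of any given copy with the
automorphisms of `H`, so the factor cancels when two host graphs are compared. -/
theorem card_copy_eq_copyCount_mul {V W : Type*} [Fintype V] [Finite W] (G : SimpleGraph V)
    (H : SimpleGraph W) : Nat.card (H.Copy G) = G.copyCount H * Nat.card (H ≃g H) := by
  classical
  have := Fintype.ofFinite W
  have : Finite (H ≃g H) := Finite.of_injective _ DFunLike.coe_injective
  let E : ∀ G' : {G' : G.Subgraph // Nonempty (H ≃g G'.coe)}, (H ≃g G'.1.coe) ≃ (H ≃g H) :=
    fun G' => ⟨fun e => e.trans G'.2.some.symm, fun e => e.trans G'.2.some,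
      fun e => RelIso.ext fun w => by simp, fun e => RelIso.ext fun w => by simp⟩
  rw [← Nat.card_congr (Equiv.ofBijective _ (bijective_coeCopy_comp G H)),
    Nat.card_congr ((Equiv.sigmaCongrRight E).trans (Equiv.sigmaEquivProd _ _)), Nat.card_prod]
  congr 1
  rw [copyCount, Nat.card_eq_fintype_card, Fintype.card_subtype]

end SimpleGraph

/-! ### Upper bound for books -/

theorem card_bookVertex (t p q : ℕ) : Nat.card (BookVertex t p q) = t + p + q + 2 := by
  have e : BookVertex t p q ≃ (Fin t ⊕ Fin p ⊕ Fin q) ⊕ Bool :=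
    { toFun := fun x => match x with
        | .u => .inr true
        | .v => .inr false
        | .page i => .inl (.inl i)
        | .leafU i => .inl (.inr (.inl i))
        | .leafV i => .inl (.inr (.inr i))
      invFun := fun x => match x with
        | .inr true => .u
        | .inr false => .v
        | .inl (.inl i) => .page i
        | .inl (.inr (.inl i)) => .leafU i
        | .inl (.inr (.inr i)) => .leafV i
      left_inv := by rintro (_ | _ | _ | _ | _) <;> rfl
      right_inv := by rintro ((_ | _ | _) | (_ | _)) <;> rfl }
  rw [Nat.card_congr e]
  simp [add_assoc]

theorem BookEdge.adj {t p q : ℕ} {x y : BookVertex t p q} (h : BookEdge t p q x y) :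
    (generalizedBook t p q).Adj x y := by
  refine (SimpleGraph.fromRel_adj _ _ _).2 ⟨?_, Or.inl h⟩
  cases h <;> simp

-- A copy is determined by the image of the arc `uv` and a choice of neighbours. Pages are recorded
-- only as neighbours of `u`, which loses little near density one.
open Classical in
theorem card_copy_generalizedBook_le {V : Type*} [Fintype V] (G : SimpleGraph V) (t p q : ℕ) :
    Nat.card ((generalizedBook t p q).Copy G) ≤
      ∑ x : {x : V × V // G.Adj x.1 x.2}, G.degree x.1.1 ^ (t + p) * G.degree x.1.2 ^ q := by
  have hinj : Function.Injective fun f : (generalizedBook t p q).Copy G =>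
      (⟨⟨(f .u, f .v), f.toHom.map_adj BookEdge.root.adj⟩,
        fun i => ⟨f (.page i), f.toHom.map_adj (BookEdge.pageU i).adj⟩,
        fun i => ⟨f (.leafU i), f.toHom.map_adj (BookEdge.leafU i).adj⟩,
        fun i => ⟨f (.leafV i), f.toHom.map_adj (BookEdge.leafV i).adj⟩⟩ :
        Σ x : {x : V × V // G.Adj x.1 x.2}, (Fin t → G.neighborSet x.1.1) ×
          (Fin p → G.neighborSet x.1.1) × (Fin q → G.neighborSet x.1.2)) := by
    intro f g h
    obtain ⟨h1, h2⟩ := Sigma.mk.inj_iff.1 h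
    have hu : f .u = g .u := congrArg (fun x => x.1.1) h1
    have hv : f .v = g .v := congrArg (fun x => x.1.2) h1
    have key : ∀ {x y : {x : V × V // G.Adj x.1 x.2}} (_ : x = y)
        {a : (Fin t → G.neighborSet x.1.1) × (Fin p → G.neighborSet x.1.1) ×
          (Fin q → G.neighborSet x.1.2)}
        {b : (Fin t → G.neighborSet y.1.1) × (Fin p → G.neighborSet y.1.1) ×
          (Fin q → G.neighborSet y.1.2)} (_ : HEq a b),
        (∀ i, (a.1 i).1 = (b.1 i).1) ∧ (∀ i, (a.2.1 i).1 = (b.2.1 i).1) ∧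
          ∀ i, (a.2.2 i).1 = (b.2.2 i).1 := by
      rintro x _ rfl a b hab
      cases hab
      exact ⟨fun _ => rfl, fun _ => rfl, fun _ => rfl⟩
    obtain ⟨h3, h4, h5⟩ := key h1 h2
    refine SimpleGraph.Copy.ext fun w => ?_
    cases w with
    | u => exact hu
    | v => exact hv
    | page i => exact h3 i
    | leafU i => exact h4 i
    | leafV i => exact h5 i
  refine (Nat.card_le_card_of_injective _ hinj).trans_eq ?_
  rw [Nat.card_eq_fintype_card, Fintype.card_sigma]
  refine Finset.sum_congr rfl fun x _ => ?_
  simp only [Fintype.card_prod, Fintype.card_fun, Fintype.card_fin,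
    SimpleGraph.card_neighborSet_eq_degree]
  ring

/-- In a dense graph the number of labelled copies of `B_t(p,q)` is at most `(2m)^(r/2)`, where `r`
is the number of vertices of `B_t(p,q)`. -/
theorem card_copy_generalizedBook_le_sqrt_pow {V : Type*} [Fintype V] (G : SimpleGraph V)
    (t p q : ℕ)
    (hdense : (Fintype.card V : ℝ) ^ 2 - 2 * G.edgeSet.ncard ≤
      (Fintype.card V : ℝ) ^ 2 / (16 * ((t + p + q : ℕ) + 1) ^ 4)) :
    (Nat.card ((generalizedBook t p q).Copy G) : ℝ) ≤
      √(2 * G.edgeSet.ncard) ^ (t + p + q + 2) := by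
  classical
  let A : V → V → ℝ := fun v u => if G.Adj v u then 1 else 0
  have hsymm : ∀ u v, A u v = A v u := fun u v => by simp [A, G.adj_comm]
  have h0 : ∀ u v, 0 ≤ A u v := fun u v => by simp only [A]; split_ifs <;> norm_num
  have h1 : ∀ u v, A u v ≤ 1 := fun u v => by simp only [A]; split_ifs <;> norm_num
  have hd : ∀ v, (G.degree v : ℝ) = ∑ u, A v u := by
    intro v
    simp [A, SimpleGraph.degree, SimpleGraph.neighborFinset_eq_filter]
  have htot : ∑ v, ∑ u, A v u = 2 * G.edgeSet.ncard := by
    rw [← Finset.sum_congr rfl fun v _ => hd v, ← SimpleGraph.coe_edgeFinset,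
      Set.ncard_coe_finset]
    exact_mod_cast G.sum_degrees_eq_twice_card_edges
  have hstar : ∑ v, (∑ u, A v u) ^ (t + p + q + 1) ≤ √(∑ v, ∑ u, A v u) ^ (t + p + q + 2) := by
    rcases Nat.eq_zero_or_pos (t + p + q) with hk | hk
    · rw [hk]
      simp only [zero_add, pow_one]
      rw [Real.sq_sqrt (Finset.sum_nonneg fun v _ => Finset.sum_nonneg fun u _ => h0 v u)]
    · exact sum_degree_pow_le_sqrt_pow A hsymm h0 h1 hk (by rw [htot]; exact hdense)
  rw [htot] at hstar
  simp only [← hd] at hstar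
  refine le_trans ?_ hstar
  have hbroom := sum_mul_degree_pow_mul_degree_pow_le A hsymm h0 (fun v => (G.degree v : ℝ)) hd
    (t + p) q
  refine le_trans ?_ hbroom
  refine (Nat.cast_le.2 (card_copy_generalizedBook_le G t p q)).trans_eq ?_
  rw [Nat.cast_sum, ← Finset.sum_product', Finset.univ_product_univ,
    ← Finset.sum_subtype (Finset.univ.filter fun x : V × V => G.Adj x.1 x.2) (by simp)
      fun x : V × V => ((G.degree x.1 ^ (t + p) * G.degree x.2 ^ q : ℕ) : ℝ), Finset.sum_filter]
  exact Finset.sum_congr rfl fun x _ => by simp [A]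

/-! ### Comparison with the quasi-clique -/

theorem two_mul_le_cliqueSize_add_one_sq (m : ℕ) : 2 * (m : ℝ) ≤ ((cliqueSize m : ℝ) + 1) ^ 2 := by
  obtain ⟨h1, h2⟩ := clique_decomposition m
  have h3 : (m : ℝ) = cliqueSize m * (cliqueSize m - 1) / 2 + cliqueRest m := by
    rw [← Nat.cast_choose_two]
    exact_mod_cast h1
  have h4 : (cliqueRest m : ℝ) ≤ cliqueSize m := by exact_mod_cast h2.le
  nlinarith

/-- The case `n = 0` fails: `cliqueSize 0 = 1`, as `b < a` forces. -/
theorem cliqueSize_le_of_le_choose_two {n m : ℕ} (hn : 1 ≤ n) (hm : m ≤ n.choose 2) :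
    cliqueSize m ≤ n := by
  by_contra! h
  have h1 : (n + 1).choose 2 ≤ _ := Nat.choose_le_choose 2 h
  have h2 : (n + 1).choose 2 = n + n.choose 2 := by simp [Nat.choose_succ_succ']
  have := (clique_decomposition m).1
  omega

theorem quasiClique_adj_of_lt {n m : ℕ} {i j : Fin n} (hij : i ≠ j) (hi : i.val < cliqueSize m)
    (hj : j.val < cliqueSize m) : (quasiClique n m).Adj i j :=
  (SimpleGraph.fromRel_adj _ _ _).2 ⟨hij, Or.inl (Or.inl ⟨hi, hj⟩)⟩

theorem descFactorial_le_card_copy_quasiClique {W : Type*} [Finite W] (H : SimpleGraph W)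
    {n m : ℕ} (h : cliqueSize m ≤ n) :
    (cliqueSize m).descFactorial (Nat.card W) ≤ Nat.card (H.Copy (quasiClique n m)) := by
  classical
  have := Fintype.ofFinite W
  have hinj : Function.Injective fun e : W ↪ Fin (cliqueSize m) =>
      (⟨⟨fun w => Fin.castLE h (e w), fun {a b} hab => quasiClique_adj_of_lt
        (fun he => hab.ne (e.injective (Fin.castLE_injective h he))) (e a).2 (e b).2⟩,
        fun a b hab => e.injective (Fin.castLE_injective h hab)⟩ : H.Copy (quasiClique n m)) := by
    intro e₁ e₂ he
    ext w
    exact congrArg (fun f : H.Copy (quasiClique n m) => (f w).val) he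
  refine le_trans (le_of_eq ?_) (Nat.card_le_card_of_injective _ hinj)
  rw [Nat.card_eq_fintype_card, Nat.card_eq_fintype_card, Fintype.card_embedding_eq,
    Fintype.card_fin]

theorem ncard_edgeSet_le_choose_two {V : Type*} [Fintype V] (G : SimpleGraph V) :
    G.edgeSet.ncard ≤ (Fintype.card V).choose 2 := by
  classical
  rw [← SimpleGraph.coe_edgeFinset, Set.ncard_coe_finset]
  exact G.card_edgeFinset_le_card_choose_two

/-- In a dense graph the number of copies of `B_t(p,q)` is asymptotically at most that in the
quasi-clique. -/
theorem copyCount_generalizedBook_le {V : Type*} [Fintype V] (G : SimpleGraph V)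
    {n m t p q R : ℕ} (hV : Fintype.card V = n) (hm : G.edgeSet.ncard = m)
    (hr : t + p + q + 2 ≤ R) (hn : 32 * R ^ 4 ≤ n)
    (hdense : (n : ℝ) ^ 2 - 2 * m ≤ (n : ℝ) ^ 2 / (16 * R ^ 4)) :
    (G.copyCount (generalizedBook t p q) : ℝ) ≤
      (1 + R / ((n : ℝ) / 2 - R)) ^ R * (quasiClique n m).copyCount (generalizedBook t p q) := by
  classical
  have hR2 : (2 : ℝ) ≤ R := by exact_mod_cast (by omega : 2 ≤ R)
  have hR1 : (1 : ℝ) ≤ (R : ℝ) ^ 3 := one_le_pow₀ (by linarith)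
  have hR4 : (R : ℝ) ≤ (R : ℝ) ^ 4 := by nlinarith
  have hn' : 32 * (R : ℝ) ^ 4 ≤ n := by exact_mod_cast hn
  have hn0 : (0 : ℝ) < (n : ℝ) / 2 - R := by linarith
  have hsR : ((t + p + q : ℕ) : ℝ) + 1 ≤ R := by
    exact_mod_cast (by omega : t + p + q + 1 ≤ R)
  set r := t + p + q + 2 with hrdef
  set a := cliqueSize m with ha
  have hdense' : (n : ℝ) ^ 2 / (16 * R ^ 4) ≤ (n : ℝ) ^ 2 / (16 * ((t + p + q : ℕ) + 1) ^ 4) := by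
    gcongr
  have hupper := card_copy_generalizedBook_le_sqrt_pow G t p q
    (by rw [hV, hm]; exact hdense.trans hdense')
  rw [hm, ← hrdef] at hupper
  have ha2 := two_mul_le_cliqueSize_add_one_sq m
  rw [← ha] at ha2
  have hsqrt : √(2 * m) ≤ (a : ℝ) + 1 := Real.sqrt_le_iff.2 ⟨by positivity, ha2⟩
  have han : (n : ℝ) / 2 ≤ a + 1 := by
    refine (abs_le_of_sq_le_sq' ?_ (by positivity)).2
    have h1 : (n : ℝ) ^ 2 / (16 * R ^ 4) ≤ (n : ℝ) ^ 2 / 16 := by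
      gcongr
      linarith
    nlinarith
  have hmn : m ≤ n.choose 2 := by
    rw [← hm, ← hV]
    exact ncard_edgeSet_le_choose_two G
  have hn1 : 1 ≤ n := by
    have : (0 : ℝ) < n := by linarith
    exact_mod_cast this
  have hlower := descFactorial_le_card_copy_quasiClique (generalizedBook t p q)
    (cliqueSize_le_of_le_choose_two hn1 hmn)
  rw [card_bookVertex, ← hrdef, ← ha] at hlower
  have hra : r ≤ a + 1 := by
    have : (r : ℝ) ≤ (a + 1 : ℕ) := by
      push_cast
      have : (r : ℝ) ≤ R := by exact_mod_cast hr
      linarith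
    exact_mod_cast this
  have hlower' : ((a : ℝ) + 1 - r) ^ r ≤ Nat.card ((generalizedBook t p q).Copy
      (quasiClique n m)) := by
    have h1 := (Nat.pow_sub_le_descFactorial a r).trans hlower
    have h2 : (((a + 1 - r : ℕ) : ℝ)) ^ r ≤ Nat.card ((generalizedBook t p q).Copy
      (quasiClique n m)) := by exact_mod_cast h1
    rwa [Nat.cast_sub hra, Nat.cast_add, Nat.cast_one] at h2
  have hrR : (r : ℝ) ≤ R := by exact_mod_cast hr
  -- As `a + 1 - r ≥ n / 2 - R`, the relative increment adds at least `R ≥ r`.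
  have hratio : ((a : ℝ) + 1) ^ r ≤ (1 + R / ((n : ℝ) / 2 - R)) ^ R * ((a : ℝ) + 1 - r) ^ r := by
    have h0 : (0 : ℝ) ≤ R / ((n : ℝ) / 2 - R) := by positivity
    have h1 : (a : ℝ) + 1 ≤ (1 + R / ((n : ℝ) / 2 - R)) * ((a : ℝ) + 1 - r) := by
      have h2 : R / ((n : ℝ) / 2 - R) * ((n : ℝ) / 2 - R) = R := div_mul_cancel₀ _ hn0.ne'
      have h3 : (n : ℝ) / 2 - R ≤ (a : ℝ) + 1 - r := by linarith
      have h4 := mul_le_mul_of_nonneg_left h3 h0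
      linarith
    have h5 : (0 : ℝ) ≤ (a : ℝ) + 1 - r := by linarith
    calc ((a : ℝ) + 1) ^ r ≤ ((1 + R / ((n : ℝ) / 2 - R)) * ((a : ℝ) + 1 - r)) ^ r := by gcongr
      _ = (1 + R / ((n : ℝ) / 2 - R)) ^ r * ((a : ℝ) + 1 - r) ^ r := mul_pow _ _ _
      _ ≤ _ := by
        gcongr
        linarith
  have haut : 0 < Nat.card (generalizedBook t p q ≃g generalizedBook t p q) := by
    have : Finite (generalizedBook t p q ≃g generalizedBook t p q) :=
      Finite.of_injective _ DFunLike.coe_injective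
    have : Nonempty (generalizedBook t p q ≃g generalizedBook t p q) := ⟨.refl⟩
    exact Nat.card_pos
  have haut' : (0 : ℝ) < Nat.card (generalizedBook t p q ≃g generalizedBook t p q) := by
    exact_mod_cast haut
  refine le_of_mul_le_mul_right ?_ haut'
  rw [mul_assoc, ← Nat.cast_mul, ← Nat.cast_mul, ← SimpleGraph.card_copy_eq_copyCount_mul,
    ← SimpleGraph.card_copy_eq_copyCount_mul]
  calc _ ≤ √(2 * m) ^ r := hupper
    _ ≤ ((a : ℝ) + 1) ^ r := by gcongr
    _ ≤ _ := hratio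
    _ ≤ _ := by gcongr

/-! ### Small `n` and conclusion -/

theorem copyCount_le_of_copy {V V' W : Type*} [Fintype V] [Fintype V'] [Finite W]
    {G : SimpleGraph V} {G' : SimpleGraph V'} (f : G.Copy G') (H : SimpleGraph W) :
    G.copyCount H ≤ G'.copyCount H := by
  classical
  have := Fintype.ofFinite W
  have hfin : Finite (H ≃g H) := Finite.of_injective _ DFunLike.coe_injective
  have hne : Nonempty (H ≃g H) := ⟨.refl⟩
  refine Nat.le_of_mul_le_mul_right ?_ (Nat.card_pos (α := H ≃g H))
  rw [← SimpleGraph.card_copy_eq_copyCount_mul, ← SimpleGraph.card_copy_eq_copyCount_mul]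
  exact Nat.card_le_card_of_injective (fun g : H.Copy G => f.comp g) fun g₁ g₂ h =>
    SimpleGraph.Copy.ext fun w => f.injective (DFunLike.congr_fun h w)

theorem quasiClique_choose_two (n : ℕ) : quasiClique n (n.choose 2) = ⊤ := by
  ext i j
  refine ⟨fun h => h.ne, fun h => ?_⟩
  have hn : 0 < n := i.pos
  have ha := (clique_decomposition_unique (m := n.choose 2) (a := n) (b := 0) rfl hn).1
  exact quasiClique_adj_of_lt h (ha ▸ i.2) (ha ▸ j.2)

theorem mainTheorem11 (Q : GraphParameter) (hQ : Q ∈ classA) :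
    ∃ c : ℝ, 0 < c ∧ ∃ δ : ℕ → ℝ, Tendsto δ atTop (𝓝 0) ∧
      ∀ n m : ℕ, (1 - c) * (n.choose 2 : ℝ) ≤ (m : ℝ) →
        ∀ (V : Type) [Fintype V] (G : SimpleGraph V),
          Fintype.card V = n → G.edgeSet.ncard = m →
            Q V G ≤ (1 + δ n) * Q (Fin n) (quasiClique n m) := by
  classical
  obtain ⟨k, w, hw, hQ⟩ := hQ
  obtain ⟨R, hR⟩ : ∃ R, R = 3 * k + 2 := ⟨_, rfl⟩
  obtain ⟨N, hN⟩ : ∃ N, N = 32 * R ^ 4 := ⟨_, rfl⟩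
  have hR2 : (2 : ℝ) ≤ R := by exact_mod_cast (by omega : 2 ≤ R)
  have hNpos : (0 : ℝ) < N := by rw [hN]; push_cast; positivity
  have hsum : ∀ (V : Type) [Fintype V] (G : SimpleGraph V) (n m : ℕ) (x : ℝ),
      (∀ t p q, t + p + q + 2 ≤ R → (G.copyCount (generalizedBook t p q) : ℝ) ≤
        x * (quasiClique n m).copyCount (generalizedBook t p q)) →
      Q V G ≤ x * Q (Fin n) (quasiClique n m) := by
    intro V _ G n m x hx
    rw [hQ, hQ]
    simp only [Finset.mul_sum]
    refine Finset.sum_le_sum fun t ht => Finset.sum_le_sum fun p hp =>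
      Finset.sum_le_sum fun q hq => ?_
    rw [Finset.mem_range] at ht hp hq
    rw [mul_left_comm]
    exact mul_le_mul_of_nonneg_left (hx t p q (by omega)) (hw t p q)
  -- For `n < N` this `c` permits less than one missing edge, so the quasi-clique is complete and `δ
  -- n = 0` works. For `n ≥ N` the diagonal term `n` and the missing edges each use at most half of
  -- the allowed deficiency `n ^ 2 / (16 * R ^ 4)`.
  refine ⟨1 / (N : ℝ) ^ 2, by positivity,
    fun n => if n < N then 0 else (1 + R / ((n : ℝ) / 2 - R)) ^ R - 1, ?_, ?_⟩
  · have h1 : Tendsto (fun n : ℕ => (n : ℝ) / 2 - R) atTop atTop :=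
      tendsto_atTop_add_const_right _ _
        (tendsto_natCast_atTop_atTop.atTop_div_const (by norm_num))
    have h2 : Tendsto (fun n : ℕ => (1 + R / ((n : ℝ) / 2 - R)) ^ R - 1) atTop (𝓝 0) := by
      have h3 := ((((tendsto_const_nhds (x := (R : ℝ))).div_atTop h1).const_add 1).pow R).sub_const
        1
      simpa using h3
    refine h2.congr' ?_
    filter_upwards [eventually_ge_atTop N] with n hn
    rw [if_neg (not_lt.2 hn)]
  · intro n m hnm V _ G hV hm
    have hmn : m ≤ n.choose 2 := by
      rw [← hm, ← hV]
      exact ncard_edgeSet_le_choose_two G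
    have hch : (n.choose 2 : ℝ) = n * (n - 1) / 2 := Nat.cast_choose_two _ _
    have hn0 : (0 : ℝ) ≤ n := n.cast_nonneg
    by_cases hn : n < N
    · have hnN : (n : ℝ) < N := by exact_mod_cast hn
      have hlt : 1 / (N : ℝ) ^ 2 * n.choose 2 < 1 := by
        rw [one_div_mul_eq_div, div_lt_one (by positivity), hch]
        nlinarith
      have hlt' : (n.choose 2 : ℝ) < (m + 1 : ℕ) := by
        push_cast
        linarith
      have hmeq : m = n.choose 2 := by
        have : n.choose 2 < m + 1 := by exact_mod_cast hlt'
        omega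
      simp only [if_pos hn, add_zero]
      refine hsum V G n m 1 fun t p q _ => ?_
      rw [one_mul, hmeq, quasiClique_choose_two]
      let e := Fintype.equivFinOfCardEq hV
      let f : G.Copy (⊤ : SimpleGraph (Fin n)) :=
        ⟨⟨e, fun {a b} hab => (SimpleGraph.top_adj _ _).2 fun h => hab.ne (e.injective h)⟩,
          e.injective⟩
      exact_mod_cast copyCount_le_of_copy f (generalizedBook t p q)
    · simp only [if_neg hn, add_sub_cancel]
      refine hsum V G n m _ fun t p q hr =>
        copyCount_generalizedBook_le G hV hm hr (by omega) ?_
      have hnN : (N : ℝ) ≤ n := by exact_mod_cast not_lt.1 hn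
      have hN' : (N : ℝ) = 32 * R ^ 4 := by rw [hN]; push_cast; ring
      have hN1 : (1 : ℝ) ≤ N := by
        rw [hN']
        nlinarith [one_le_pow₀ (n := 4) (by linarith : (1 : ℝ) ≤ R)]
      have hc : 1 / (N : ℝ) ^ 2 ≤ 1 / N := by
        apply one_div_le_one_div_of_le hNpos
        nlinarith
      have h1 : (n : ℝ) ^ 2 / (16 * R ^ 4) = 2 * ((n : ℝ) ^ 2 * (1 / N)) := by
        rw [hN']
        field_simp
        ring
      have h2 : (n : ℝ) ≤ (n : ℝ) ^ 2 * (1 / N) := by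
        rw [mul_one_div, le_div_iff₀ hNpos]
        nlinarith
      have h3 : 1 / (N : ℝ) ^ 2 * (n * (n - 1)) ≤ (n : ℝ) ^ 2 * (1 / N) := by
        calc 1 / (N : ℝ) ^ 2 * (n * (n - 1)) ≤ 1 / (N : ℝ) ^ 2 * (n : ℝ) ^ 2 := by
              gcongr
              nlinarith
          _ ≤ 1 / N * (n : ℝ) ^ 2 := by gcongr
          _ = _ := mul_comm _ _
      rw [h1]
      rw [hch] at hnm
      linarith
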